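/- Let $\mathbb T=\mathbb R/\mathbb Z$ with its usual metric, and let $\mathcal C(\mathbb T)$ be the Banach space of continuous functions $f:\mathbb T\to\mathbb C$ with the supremum norm. For $f\in\mathcal C(\mathbb T)$, $n\ge 0$ and $x\in\mathbb T$ let $$S_nf(x)=\sum_{k=-n}^{n}\Big(\int_{\mathbb T} f(t)e^{-2\pi i k t}\,dt\Big)e^{2\pi i k x}$$ be the $n$-th partial sum of the Fourier series of $f$, and let $$F(1,f)=\Big\{x\in\mathbb T:\ \limsup_{n\to+\infty}\frac{\log|S_nf(x)|}{\log\log n}=1\Big\}$$ (with $\log 0=-\infty$). Then for quasi-all $f\in\mathcal C(\mathbb T)$, that is, for all $f$ in a residual (comeager) subset of $\mathcal C(\mathbb T)$, the Hausdorff dimension of $F(1,f)$ is equal to $1$. -/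

import Mathlib

/-- The `n`-th symmetric partial sum `S_n f(x) = ∑_{|k| ≤ n} ⟨f, e_k⟩ e_k(x)` of the Fourier series
of a function `f` on the circle `𝕋 = ℝ/ℤ`, where `e_k(t) = exp(2πikt)`. -/
noncomputable def fourierPartialSum (n : ℕ) (f : UnitAddCircle → ℂ) (x : UnitAddCircle) : ℂ :=
  ∑ k ∈ Finset.Icc (-(n : ℤ)) (n : ℤ), fourierCoeff f k * fourier k x

/-- The level set `F(β, f)` of the points `x` of the circle such that
`limsup_{n → ∞} log |S_n f(x)| / log log n = β`. The limsup is taken in the extended real line and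
`ENNReal.log` is the logarithm with values there, so that `log 0 = -∞`. -/
noncomputable def logDivergenceLevelSet (β : ℝ) (f : UnitAddCircle → ℂ) : Set UnitAddCircle :=
  {x | Filter.limsup
      (fun n : ℕ => ENNReal.log ‖fourierPartialSum n f x‖ₑ / ((Real.log (Real.log n) : ℝ) : EReal))
      Filter.atTop = (β : EReal)}

/-! The bound `‖S_n f‖ ≤ C log n ‖f‖` (`norm_fourierPartialSum_le`) makes the limsup at most 1 at
every point, for every `f`. For the converse, one set `gapSet` of dimension 1, independent of `f`,
serves quasi-all `f` at once.

Its points have binary digits vanishing on blocks of length `l_j = 2^(j²)`, the `j`-th placed after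
`2^j l_j` free digits. The blocks have density zero, so no dimension is lost (`one_le_dimH_gapSet`).
On `gapSet`, a suitable power of two `K` brings `K x` within `2^(-l_j) / 8` of an integer; there a
bounded Fejér polynomial dilated by `K` has a partial sum of order `n_j = K 2^(l_j)` and size at
least `l_j / 4`.

Since `log n_j = O(2^j l_j)`, only a factor exponential in `j` is lost against `log n_j`, while `log
log n_j` grows at least like `j²`: the exponent 1 survives. Adding small multiples of these
polynomials to trigonometric polynomials gives the density needed for Baire's argument
(`dense_interior_largePartialSums`). -/

/-! ### The Dirichlet kernel and the logarithmic bound. -/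

/-- The Dirichlet kernel on the circle. -/
noncomputable def dirichletKernel (n : ℕ) (x : UnitAddCircle) : ℂ :=
  ∑ k ∈ Finset.Icc (-(n : ℤ)) (n : ℤ), fourier k x

theorem continuous_dirichletKernel (n : ℕ) : Continuous (dirichletKernel n) := by
  unfold dirichletKernel
  fun_prop

theorem norm_fourier_apply (k : ℤ) (x : UnitAddCircle) : ‖(fourier k x : ℂ)‖ = 1 := by
  rw [fourier_apply]; exact Circle.norm_coe _

theorem norm_dirichletKernel_le (n : ℕ) (x : UnitAddCircle) :
    ‖dirichletKernel n x‖ ≤ 2 * n + 1 := by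
  refine (norm_sum_le _ _).trans ?_
  simp only [norm_fourier_apply, Finset.sum_const, nsmul_eq_mul, mul_one, Int.card_Icc]
  have : ((n : ℤ) + 1 - -(n : ℤ)).toNat = 2 * n + 1 := by omega
  rw [this]; push_cast; exact le_rfl

theorem fourier_one_sub_one_mul_dirichletKernel (n : ℕ) (x : UnitAddCircle) :
    ((fourier 1 x : ℂ) - 1) * dirichletKernel n x = fourier ((n : ℤ) + 1) x - fourier (-(n : ℤ)) x := by
  induction n with
  | zero => simp [dirichletKernel]
  | succ n ih =>
    have h : dirichletKernel (n + 1) x = dirichletKernel n x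
        + (fourier ((n : ℤ) + 1) x + fourier (-((n : ℤ) + 1)) x) := by
      unfold dirichletKernel
      push_cast
      rw [Finset.sum_Icc_succ_eq_add_endpoints, add_comm]
    rw [h, mul_add, ih]
    have h1 : (fourier ((n : ℤ) + 1 + 1) x : ℂ) = fourier ((n : ℤ) + 1) x * fourier 1 x := fourier_add
    have h2 : (fourier (-(n : ℤ)) x : ℂ) = fourier (-((n : ℤ) + 1)) x * fourier 1 x := by
      rw [← fourier_add]; congr 2; ring
    push_cast
    rw [h1, h2]
    ring

theorem four_mul_abs_le_norm_fourier_one_sub_one {y : ℝ} (hy : |y| ≤ 1 / 2) :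
    4 * |y| ≤ ‖(fourier 1 (y : UnitAddCircle) : ℂ) - 1‖ := by
  have h : (fourier 1 (y : UnitAddCircle) : ℂ) = Complex.exp (Complex.I * ((2 * Real.pi * y : ℝ) : ℂ)) := by
    rw [fourier_coe_apply]; congr 1; push_cast; ring
  rw [h, Complex.norm_exp_I_mul_ofReal_sub_one, norm_mul, Real.norm_eq_abs (Real.sin _)]
  have h1 : |2 * Real.pi * y / 2| ≤ Real.pi / 2 := by
    rw [show 2 * Real.pi * y / 2 = Real.pi * y by ring, abs_mul, abs_of_pos Real.pi_pos]
    nlinarith [Real.pi_pos]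
  have h2 := Real.mul_abs_le_abs_sin h1
  rw [show 2 * Real.pi * y / 2 = Real.pi * y by ring, abs_mul, abs_of_pos Real.pi_pos,
    show 2 / Real.pi * (Real.pi * |y|) = 2 * |y| by field_simp] at h2
  rw [show 2 * Real.pi * y / 2 = Real.pi * y by ring]
  norm_num
  linarith

/-- Adding the trivial bound, divided by `2n + 1`, to the bound from the geometric sum yields a
single majorant with an explicit integral, so the integral need not be split at `1 / n`. -/
theorem norm_dirichletKernel_le_div (n : ℕ) {y : ℝ} (hy : |y| ≤ 1 / 2) :
    ‖dirichletKernel n (y : UnitAddCircle)‖ ≤ 2 / ((2 * (n : ℝ) + 1)⁻¹ + 2 * |y|) := by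
  have hn : (0 : ℝ) < 2 * n + 1 := by positivity
  have h1 := norm_dirichletKernel_le n (y : UnitAddCircle)
  have h2 := congrArg norm (fourier_one_sub_one_mul_dirichletKernel n (y : UnitAddCircle))
  rw [norm_mul] at h2
  have h3 := norm_sub_le (fourier ((n : ℤ) + 1) (y : UnitAddCircle) : ℂ) (fourier (-(n : ℤ)) (y : UnitAddCircle))
  rw [norm_fourier_apply, norm_fourier_apply] at h3
  have h4 := mul_le_mul_of_nonneg_right (four_mul_abs_le_norm_fourier_one_sub_one hy)
    (norm_nonneg (dirichletKernel n (y : UnitAddCircle)))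
  rw [le_div_iff₀ (by positivity), mul_add]
  have h5 : ‖dirichletKernel n (y : UnitAddCircle)‖ * (2 * (n : ℝ) + 1)⁻¹ ≤ 1 := by
    rw [← div_eq_mul_inv, div_le_one hn]; exact h1
  linarith

theorem integral_two_div_add_two_mul_abs {c : ℝ} (hc : 0 < c) :
    ∫ y in (-(1 / 2) : ℝ)..(1 / 2), 2 / (c + 2 * |y|) = 2 * Real.log ((c + 1) / c) := by
  have hcont : Continuous fun y : ℝ => 2 / (c + 2 * |y|) :=
    continuous_const.div (by fun_prop) (fun y => by positivity)
  have h1 : ∫ y in (0 : ℝ)..(1 / 2), 2 / (c + 2 * |y|) = Real.log ((c + 1) / c) := by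
    have : ∀ y ∈ Set.uIcc (0 : ℝ) (1 / 2),
        HasDerivAt (fun y => Real.log (c + 2 * y)) (2 / (c + 2 * |y|)) y := by
      intro y hy
      rw [Set.uIcc_of_le (by norm_num)] at hy
      rw [abs_of_nonneg hy.1]
      have h : HasDerivAt (fun y : ℝ => c + 2 * y) 2 y := by
        simpa using ((hasDerivAt_id y).const_mul 2).const_add c
      exact h.log (by linarith [hy.1])
    rw [intervalIntegral.integral_eq_sub_of_hasDerivAt this (hcont.intervalIntegrable _ _),
      Real.log_div (by positivity) hc.ne']
    norm_num
  have h2 : ∫ y in (-(1 / 2) : ℝ)..0, 2 / (c + 2 * |y|) = Real.log ((c + 1) / c) := by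
    rw [← h1]
    have := intervalIntegral.integral_comp_neg (a := 0) (b := 1 / 2) (fun y : ℝ => 2 / (c + 2 * |y|))
    simp only [abs_neg, neg_zero] at this
    exact this.symm
  rw [← intervalIntegral.integral_add_adjacent_intervals (hcont.intervalIntegrable _ 0)
    (hcont.intervalIntegrable 0 _), h1, h2]
  ring

theorem integral_norm_dirichletKernel_le (n : ℕ) :
    ∫ x, ‖dirichletKernel n x‖ ∂AddCircle.haarAddCircle ≤ 2 * Real.log (2 * n + 2) := by
  have hc : (0 : ℝ) < (2 * (n : ℝ) + 1)⁻¹ := by positivity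
  have h := integral_two_div_add_two_mul_abs hc
  have h' : ((2 * (n : ℝ) + 1)⁻¹ + 1) / (2 * (n : ℝ) + 1)⁻¹ = 2 * n + 2 := by
    field_simp; ring
  rw [h'] at h
  rw [← h, AddCircle.integral_haarAddCircle, inv_one, one_smul]
  have hp := AddCircle.intervalIntegral_preimage 1 (-(1 / 2)) (fun x => ‖dirichletKernel n x‖)
  rw [← hp]
  norm_num
  have hcont : Continuous fun y : ℝ => 2 / ((2 * (n : ℝ) + 1)⁻¹ + 2 * |y|) :=
    continuous_const.div (by fun_prop) (fun y => by positivity)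
  refine intervalIntegral.integral_mono_on (by norm_num) ?_ (hcont.intervalIntegrable _ _) ?_
  · exact ((continuous_dirichletKernel n).comp (AddCircle.continuous_mk' 1)).norm.intervalIntegrable _ _
  · intro y hy
    exact norm_dirichletKernel_le_div n (abs_le.2 ⟨by linarith [hy.1], by linarith [hy.2]⟩)

theorem fourierPartialSum_eq_integral (n : ℕ) (f : C(UnitAddCircle, ℂ)) (x : UnitAddCircle) :
    fourierPartialSum n f x = ∫ t, f t * dirichletKernel n (x - t) ∂AddCircle.haarAddCircle := by
  have hk : ∀ t : UnitAddCircle, f t * dirichletKernel n (x - t) =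
      ∑ k ∈ Finset.Icc (-(n : ℤ)) (n : ℤ), fourier (-k) t * f t * fourier k x := by
    intro t
    rw [dirichletKernel, Finset.mul_sum]
    refine Finset.sum_congr rfl fun k _ => ?_
    have : (fourier k (x - t) : ℂ) = fourier k x * fourier (-k) t := by
      rw [fourier_apply, fourier_apply, fourier_apply, ← Circle.coe_mul, ← AddCircle.toCircle_add,
        smul_sub, neg_smul, sub_eq_add_neg]
    rw [this]; ring
  simp_rw [hk]
  rw [MeasureTheory.integral_finsetSum]
  · refine Finset.sum_congr rfl fun k _ => ?_
    rw [MeasureTheory.integral_mul_const]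
    simp [fourierCoeff]
  · intro k _
    exact Continuous.integrable_of_hasCompactSupport (by fun_prop) (HasCompactSupport.of_compactSpace _)

/-- The logarithmic bound on the partial sums of the Fourier series of a continuous function. -/
theorem norm_fourierPartialSum_le (n : ℕ) (f : C(UnitAddCircle, ℂ)) (x : UnitAddCircle) :
    ‖fourierPartialSum n f x‖ ≤ 2 * Real.log (2 * n + 2) * ‖f‖ := by
  rw [fourierPartialSum_eq_integral]
  have hc : Continuous fun t => ‖dirichletKernel n (x - t)‖ :=
    ((continuous_dirichletKernel n).comp (by fun_prop)).norm
  calc ‖∫ t, f t * dirichletKernel n (x - t) ∂AddCircle.haarAddCircle‖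
      ≤ ∫ t, ‖f‖ * ‖dirichletKernel n (x - t)‖ ∂AddCircle.haarAddCircle := by
        refine MeasureTheory.norm_integral_le_of_norm_le ?_ (Filter.Eventually.of_forall fun t => ?_)
        · exact Continuous.integrable_of_hasCompactSupport (by fun_prop)
            (HasCompactSupport.of_compactSpace _)
        · rw [norm_mul]
          exact mul_le_mul_of_nonneg_right (f.norm_coe_le_norm t) (norm_nonneg _)
    _ = ‖f‖ * ∫ t, ‖dirichletKernel n t‖ ∂AddCircle.haarAddCircle := by
        rw [MeasureTheory.integral_const_mul,
          MeasureTheory.integral_sub_left_eq_self (fun t => ‖dirichletKernel n t‖)]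
    _ ≤ _ := by
        rw [mul_comm]
        exact mul_le_mul_of_nonneg_right (integral_norm_dirichletKernel_le n) (norm_nonneg _)

/-! ### Linearity, and partial sums of trigonometric polynomials. -/

theorem fourierPartialSum_add (n : ℕ) (f g : C(UnitAddCircle, ℂ)) (x : UnitAddCircle) :
    fourierPartialSum n (f + g : C(UnitAddCircle, ℂ)) x
      = fourierPartialSum n f x + fourierPartialSum n g x := by
  have hi : ∀ f : C(UnitAddCircle, ℂ), MeasureTheory.Integrable f AddCircle.haarAddCircle :=
    fun f => f.continuous.integrable_of_hasCompactSupport (HasCompactSupport.of_compactSpace _)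
  simp only [fourierPartialSum, ContinuousMap.coe_add, fourierCoeff.add (hi f) (hi g),
    Pi.add_apply, add_mul, Finset.sum_add_distrib]

theorem fourierPartialSum_smul (n : ℕ) (c : ℂ) (f : C(UnitAddCircle, ℂ)) (x : UnitAddCircle) :
    fourierPartialSum n (c • f : C(UnitAddCircle, ℂ)) x = c * fourierPartialSum n f x := by
  simp only [fourierPartialSum, ContinuousMap.coe_smul, fourierCoeff.const_smul,
    smul_eq_mul, Finset.mul_sum, mul_assoc]

/-- The partial sum of the Fourier series as a linear map, at a given point. -/
noncomputable def fourierPartialSumLinear (n : ℕ) (x : UnitAddCircle) :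
    C(UnitAddCircle, ℂ) →ₗ[ℂ] ℂ where
  toFun f := fourierPartialSum n f x
  map_add' f g := fourierPartialSum_add n f g x
  map_smul' c f := fourierPartialSum_smul n c f x

theorem fourierPartialSum_fourier (n : ℕ) (k : ℤ) (x : UnitAddCircle) :
    fourierPartialSum n (fourier k) x = if |k| ≤ n then fourier k x else 0 := by
  simp only [fourierPartialSum, fourierCoeff_fourier, Pi.single_apply, ite_mul, one_mul, zero_mul]
  rw [Finset.sum_ite_eq']
  simp [abs_le]

theorem exists_forall_fourierPartialSum_eq {g : C(UnitAddCircle, ℂ)}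
    (hg : g ∈ Submodule.span ℂ (Set.range (@fourier 1))) :
    ∃ N : ℕ, ∀ n ≥ N, ∀ x, fourierPartialSum n g x = g x := by
  induction hg using Submodule.span_induction with
  | mem g hg =>
    obtain ⟨k, rfl⟩ := hg
    refine ⟨k.natAbs, fun n hn x => ?_⟩
    rw [fourierPartialSum_fourier, if_pos (by rw [Int.abs_eq_natAbs]; exact_mod_cast hn)]
  | zero => exact ⟨0, fun n _ x => (fourierPartialSumLinear n x).map_zero⟩
  | add f g _ _ hf hg =>
    obtain ⟨N, hN⟩ := hf
    obtain ⟨M, hM⟩ := hg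
    refine ⟨max N M, fun n hn x => ?_⟩
    rw [fourierPartialSum_add, hN n (le_trans (le_max_left _ _) hn),
      hM n (le_trans (le_max_right _ _) hn)]
    rfl
  | smul c f _ hf =>
    obtain ⟨N, hN⟩ := hf
    refine ⟨N, fun n hn x => ?_⟩
    rw [fourierPartialSum_smul, hN n hn]
    rfl

/-! ### Sawtooth sums and Fejér polynomials. -/

/-- Summation by parts. The boundary term and the subtracted `A / (M + d + 1)` are kept so that the
induction telescopes. -/
theorem abs_sum_sub_div_sub_le {C : ℕ → ℝ} {A : ℝ} (hC : ∀ k, |C k| ≤ A) (M d : ℕ) :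
    |∑ k ∈ Finset.range d, (C (M + k + 1) - C (M + k)) / ((M + k : ℕ) + 1 : ℝ)
      - C (M + d) / ((M + d : ℕ) + 1 : ℝ)| ≤ 2 * A / (M + 1) - A / ((M + d : ℕ) + 1 : ℝ) := by
  induction d with
  | zero =>
    simp only [Finset.range_zero, Finset.sum_empty, zero_sub, abs_neg, add_zero]
    rw [abs_div, abs_of_pos (by positivity : (0 : ℝ) < (M : ℝ) + 1), ← sub_div]
    gcongr
    linarith [hC M]
  | succ d ih =>
    rw [Finset.sum_range_succ]
    set T := ∑ k ∈ Finset.range d, (C (M + k + 1) - C (M + k)) / ((M + k : ℕ) + 1 : ℝ)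
    set a : ℝ := ((M + d : ℕ) : ℝ) + 1 with ha
    have hp : 0 < a := by positivity
    have h1 : (((M + (d + 1) : ℕ) : ℝ) + 1) = a + 1 := by rw [ha]; push_cast; ring
    rw [h1, show M + (d + 1) = M + d + 1 by ring]
    have h2 : T + (C (M + d + 1) - C (M + d)) / a - C (M + d + 1) / (a + 1)
        = (T - C (M + d) / a) + C (M + d + 1) * (1 / a - 1 / (a + 1)) := by ring
    have h3 : 0 ≤ 1 / a - 1 / (a + 1) := by
      rw [sub_nonneg]; exact one_div_le_one_div_of_le hp (by linarith)
    have h4 : |C (M + d + 1) * (1 / a - 1 / (a + 1))| ≤ A * (1 / a - 1 / (a + 1)) := by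
      rw [abs_mul, abs_of_nonneg h3]
      exact mul_le_mul_of_nonneg_right (hC _) h3
    have h5 : A * (1 / a - 1 / (a + 1)) = A / a - A / (a + 1) := by ring
    rw [h2]
    refine (abs_add_le _ _).trans ?_
    linarith

theorem abs_sin_nat_mul_le (k : ℕ) (x : ℝ) : |Real.sin (k * x)| ≤ k * |Real.sin x| := by
  induction k with
  | zero => simp
  | succ k ih =>
    push_cast
    rw [add_mul, one_mul, Real.sin_add]
    refine (abs_add_le _ _).trans ?_
    rw [abs_mul, abs_mul]
    have h1 := Real.abs_cos_le_one x
    have h2 := Real.abs_cos_le_one (k * x)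
    nlinarith [abs_nonneg (Real.sin (k * x)), abs_nonneg (Real.sin x)]

theorem abs_sin_nat_mul_le_two_mul (k : ℕ) (x : ℝ) :
    |Real.sin (k * x)| ≤ 2 * k * |Real.sin (x / 2)| := by
  refine (abs_sin_nat_mul_le k x).trans ?_
  have : |Real.sin x| ≤ 2 * |Real.sin (x / 2)| := by
    have := abs_sin_nat_mul_le 2 (x / 2)
    rwa [show ((2 : ℕ) : ℝ) * (x / 2) = x by push_cast; ring] at this
  nlinarith [(Nat.cast_nonneg k : (0 : ℝ) ≤ k)]

/-- The partial sums of the sawtooth series `∑ sin (k θ) / k` are uniformly bounded. -/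
theorem abs_sum_sin_div_le (n : ℕ) (θ : ℝ) :
    |∑ k ∈ Finset.range n, Real.sin ((k + 1 : ℕ) * θ) / ((k : ℝ) + 1)| ≤ 3 := by
  set σ := |Real.sin (θ / 2)| with hσ
  have hσ0 : 0 ≤ σ := abs_nonneg _
  have hsmall : ∀ m : ℕ,
      |∑ k ∈ Finset.range m, Real.sin ((k + 1 : ℕ) * θ) / ((k : ℝ) + 1)| ≤ m * (2 * σ) := by
    intro m
    refine (Finset.abs_sum_le_sum_abs _ _).trans ?_
    have : ∀ k ∈ Finset.range m, |Real.sin ((k + 1 : ℕ) * θ) / ((k : ℝ) + 1)| ≤ 2 * σ := by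
      intro k _
      rw [abs_div, abs_of_pos (by positivity : (0 : ℝ) < (k : ℝ) + 1), div_le_iff₀ (by positivity)]
      have := abs_sin_nat_mul_le_two_mul (k + 1) θ
      push_cast at this ⊢
      linarith
    simpa using Finset.sum_le_sum this
  rcases hσ0.eq_or_lt with h0 | hpos
  · have := hsmall n
    rw [← h0] at this
    linarith
  -- Below this cutoff each term is at most `2σ`, for a total of at most 2; beyond it, summation by
  -- parts contributes at most 1.
  set M := ⌊1 / σ⌋₊ with hM
  have hM1 : (M : ℝ) * σ ≤ 1 := by
    have := Nat.floor_le (by positivity : 0 ≤ 1 / σ)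
    rwa [le_div_iff₀ hpos] at this
  have hM2 : 1 ≤ σ * (M + 1) := by
    have := (Nat.lt_floor_add_one (1 / σ)).le
    rwa [div_le_iff₀ hpos, mul_comm] at this
  rcases le_total n M with hn | hn
  · refine (hsmall n).trans ?_
    have : (n : ℝ) ≤ M := by exact_mod_cast hn
    nlinarith
  obtain ⟨d, rfl⟩ := Nat.exists_eq_add_of_le hn
  rw [Finset.sum_range_add]
  refine (abs_add_le _ _).trans ?_
  have hs : Real.sin (θ / 2) ≠ 0 := by
    intro h; rw [h, abs_zero] at hσ; exact hpos.ne' hσ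
  set C : ℕ → ℝ := fun k => -Real.cos ((k + 1 / 2) * θ) / (2 * Real.sin (θ / 2)) with hC
  have hCb : ∀ k, |C k| ≤ 1 / (2 * σ) := by
    intro k
    rw [hC]
    simp only [abs_div, abs_neg, abs_mul, abs_two]
    gcongr
    exact Real.abs_cos_le_one _
  have hdiff : ∀ k : ℕ, Real.sin ((k + 1 : ℕ) * θ) = C (k + 1) - C k := by
    intro k
    rw [hC]
    simp only
    rw [← sub_div, eq_div_iff (by positivity)]
    have h1 : (((k + 1 : ℕ) : ℝ) + 1 / 2) * θ = (k + 1 : ℕ) * θ + θ / 2 := by ring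
    have h2 : ((k : ℝ) + 1 / 2) * θ = (k + 1 : ℕ) * θ - θ / 2 := by push_cast; ring
    rw [h1, h2, Real.cos_add, Real.cos_sub]
    ring
  have key := abs_sum_sub_div_sub_le hCb M d
  have hlast : |C (M + d) / ((M + d : ℕ) + 1 : ℝ)| ≤ 1 / (2 * σ) / ((M + d : ℕ) + 1 : ℝ) := by
    rw [abs_div, abs_of_pos (by positivity : (0 : ℝ) < ((M + d : ℕ) : ℝ) + 1)]
    gcongr
    exact hCb _
  have hA : 2 * (1 / (2 * σ)) / ((M : ℝ) + 1) ≤ 1 := by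
    rw [div_le_one (by positivity), show 2 * (1 / (2 * σ)) = 1 / σ by field_simp,
      div_le_iff₀ hpos]
    linarith
  have hfirst := hsmall M
  have hsum : ∑ k ∈ Finset.range d, Real.sin ((M + k + 1 : ℕ) * θ) / (((M + k : ℕ) : ℝ) + 1)
      = ∑ k ∈ Finset.range d, (C (M + k + 1) - C (M + k)) / ((M + k : ℕ) + 1 : ℝ) :=
    Finset.sum_congr rfl fun k _ => by rw [hdiff (M + k)]
  rw [hsum]
  have h3 := abs_sub_abs_le_abs_sub
    (∑ k ∈ Finset.range d, (C (M + k + 1) - C (M + k)) / ((M + k : ℕ) + 1 : ℝ))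
    (C (M + d) / ((M + d : ℕ) + 1 : ℝ))
  linarith

/-- The Fejér polynomial, dilated by `K`: bounded, while the modulus of its partial sum of order
`K * n` is of order `log n` near the multiples of `1 / K`. -/
noncomputable def fejerPolynomial (K n : ℕ) : C(UnitAddCircle, ℂ) :=
  ∑ k ∈ Finset.range n, (((k : ℂ) + 1)⁻¹) •
    (fourier ((K : ℤ) * (n + k + 1)) - fourier ((K : ℤ) * (n - k - 1)) : C(UnitAddCircle, ℂ))

/-- The frequencies are symmetric about `K n`, so factoring out that exponential leaves `2i` times a
sawtooth sum. -/
theorem norm_fejerPolynomial_le (K n : ℕ) : ‖fejerPolynomial K n‖ ≤ 6 := by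
  rw [ContinuousMap.norm_le _ (by norm_num)]
  intro x
  induction x using QuotientAddGroup.induction_on with | H y => ?_
  change ‖fejerPolynomial K n (y : UnitAddCircle)‖ ≤ 6
  set θ : ℝ := 2 * Real.pi * (K * y) with hθ
  have h : fejerPolynomial K n (y : UnitAddCircle) = fourier ((K : ℤ) * n) (y : UnitAddCircle) *
      (2 * Complex.I * ((∑ k ∈ Finset.range n, Real.sin ((k + 1 : ℕ) * θ) / ((k : ℝ) + 1) : ℝ) : ℂ)) := by
    rw [fejerPolynomial, ContinuousMap.sum_apply]
    push_cast
    rw [Finset.mul_sum, Finset.mul_sum]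
    refine Finset.sum_congr rfl fun k _ => ?_
    have h1 : (fourier ((K : ℤ) * (n + k + 1)) (y : UnitAddCircle) : ℂ)
        = fourier ((K : ℤ) * n) (y : UnitAddCircle) * Complex.exp ((((k : ℂ) + 1) * θ) * Complex.I) := by
      rw [fourier_coe_apply, fourier_coe_apply, ← Complex.exp_add, hθ]
      congr 1; push_cast; ring
    have h2 : (fourier ((K : ℤ) * (n - k - 1)) (y : UnitAddCircle) : ℂ)
        = fourier ((K : ℤ) * n) (y : UnitAddCircle) * Complex.exp (-(((k : ℂ) + 1) * θ) * Complex.I) := by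
      rw [fourier_coe_apply, fourier_coe_apply, ← Complex.exp_add, hθ]
      congr 1; push_cast; ring
    rw [Pi.smul_apply, Pi.sub_apply, h1, h2, Complex.sin, smul_eq_mul]
    field_simp
    rw [Complex.I_sq]
    ring
  rw [h, norm_mul, norm_fourier_apply, norm_mul, norm_mul, Complex.norm_I, Complex.norm_real,
    Real.norm_eq_abs, Complex.norm_two]
  have := abs_sum_sin_div_le n θ
  linarith

/-- Truncation at the centre of symmetry keeps only the lower half of the spectrum, which destroys
the cancellation. -/
theorem fourierPartialSum_fejerPolynomial {K : ℕ} (hK : 0 < K) (n : ℕ) (x : UnitAddCircle) :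
    fourierPartialSum (K * n) (fejerPolynomial K n) x
      = -∑ k ∈ Finset.range n, ((k : ℂ) + 1)⁻¹ * fourier ((K : ℤ) * (n - k - 1)) x := by
  change fourierPartialSumLinear (K * n) x (fejerPolynomial K n) = _
  rw [fejerPolynomial, map_sum, ← Finset.sum_neg_distrib]
  refine Finset.sum_congr rfl fun k hk => ?_
  rw [map_smul, map_sub]
  change (_ : ℂ) * (fourierPartialSum _ _ _ - fourierPartialSum _ _ _) = _
  have hk' : (k : ℤ) + 1 ≤ n := by exact_mod_cast Finset.mem_range.1 hk
  have hK' : (0 : ℤ) < K := by exact_mod_cast hK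
  rw [fourierPartialSum_fourier, fourierPartialSum_fourier, if_neg, if_pos]
  · ring
  · rw [abs_of_nonneg (mul_nonneg hK'.le (by linarith))]
    push_cast
    exact mul_le_mul_of_nonneg_left (by linarith) hK'.le
  · rw [abs_of_nonneg (by positivity), not_le]
    push_cast
    exact mul_lt_mul_of_pos_left (by linarith) hK'

/-- The phase is at most `2π / 8 ≤ 1` modulo `2π`, and `cos α ≥ 1 - α² / 2`. Hence the terms of the
truncated polynomial do not cancel and a harmonic sum remains. -/
theorem half_le_re_fourier {K n m : ℕ} {y : ℝ} {z : ℤ} (hm : m ≤ n)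
    (hz : n * |K * y - z| ≤ 1 / 8) :
    1 / 2 ≤ (fourier ((K : ℤ) * m) (y : UnitAddCircle) : ℂ).re := by
  set α : ℝ := 2 * Real.pi * (m * (K * y - z)) with hα
  have h : (fourier ((K : ℤ) * m) (y : UnitAddCircle) : ℂ) = Complex.exp (α * Complex.I) := by
    have h1 := Complex.exp_int_mul_two_pi_mul_I (-(z * m))
    rw [fourier_coe_apply, ← mul_one (Complex.exp _), ← h1, ← Complex.exp_add]
    congr 1
    rw [hα]; push_cast; ring
  rw [h, Complex.exp_ofReal_mul_I_re]
  have hm' : (m : ℝ) ≤ n := by exact_mod_cast hm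
  have hb : |m * (K * y - z)| ≤ 1 / 8 := by
    rw [abs_mul, Nat.abs_cast]
    exact (mul_le_mul_of_nonneg_right hm' (abs_nonneg _)).trans hz
  have hα1 : |α| ≤ 1 := by
    rw [hα, abs_mul, abs_of_pos (by positivity : (0 : ℝ) < 2 * Real.pi)]
    nlinarith [Real.pi_pos, Real.pi_lt_four]
  have hc := Real.one_sub_sq_div_two_le_cos (x := α)
  have : α ^ 2 ≤ 1 := by rw [← sq_abs]; exact pow_le_one₀ (abs_nonneg _) hα1
  linarith

theorem half_log_le_norm_fourierPartialSum_fejerPolynomial {K n : ℕ} (hK : 0 < K) {y : ℝ} {z : ℤ}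
    (hz : n * |K * y - z| ≤ 1 / 8) :
    Real.log (n + 1) / 2
      ≤ ‖fourierPartialSum (K * n) (fejerPolynomial K n) (y : UnitAddCircle)‖ := by
  rw [fourierPartialSum_fejerPolynomial hK, norm_neg]
  refine le_trans ?_ (Complex.re_le_norm _)
  rw [Complex.re_sum]
  have h1 : Real.log (n + 1) ≤ ∑ k ∈ Finset.range n, ((k : ℝ) + 1)⁻¹ := by
    have := log_add_one_le_harmonic n
    simpa [harmonic] using this
  calc Real.log (n + 1) / 2 ≤ (∑ k ∈ Finset.range n, ((k : ℝ) + 1)⁻¹) / 2 := by linarith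
    _ = ∑ k ∈ Finset.range n, ((k : ℝ) + 1)⁻¹ * (1 / 2) := by rw [← Finset.sum_mul]; ring
    _ ≤ _ := by
      refine Finset.sum_le_sum fun k hk => ?_
      have hk' : k + 1 ≤ n := Finset.mem_range.1 hk
      have h2 : ((k : ℂ) + 1)⁻¹ = (((k : ℝ) + 1)⁻¹ : ℝ) := by push_cast; rfl
      have h3 : (n : ℤ) - k - 1 = ((n - k - 1 : ℕ) : ℤ) := by omega
      rw [h2, Complex.re_ofReal_mul, h3]
      exact mul_le_mul_of_nonneg_left (half_le_re_fourier (by omega) hz) (by positivity)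
-- Spreading binary digits and Hausdorff dimension.
open Set Filter Topology
open scoped NNReal

/-- The binary digit of `t` of weight `2 ^ (-(i + 1))`. -/
noncomputable def binaryDigit (t : ℝ) (i : ℕ) : ℤ := ⌊2 ^ (i + 1) * t⌋ - 2 * ⌊2 ^ i * t⌋

theorem binaryDigit_nonneg (t : ℝ) (i : ℕ) : 0 ≤ binaryDigit t i := by
  unfold binaryDigit
  rw [sub_nonneg, Int.le_floor]
  push_cast
  rw [pow_succ]
  linarith [Int.floor_le (2 ^ i * t)]

theorem binaryDigit_le_one (t : ℝ) (i : ℕ) : binaryDigit t i ≤ 1 := by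
  unfold binaryDigit
  have : ⌊2 ^ (i + 1) * t⌋ < 2 * ⌊2 ^ i * t⌋ + 2 := by
    rw [Int.floor_lt]
    push_cast
    rw [pow_succ]
    linarith [Int.lt_floor_add_one (2 ^ i * t)]
  omega

/-- The real number in `[0, 1]` whose binary digits are those of `t`, the `i`-th one being moved to
the position `pos i`. -/
noncomputable def spreadDigits (pos : ℕ → ℕ) (t : ℝ) : ℝ :=
  ∑' i, (binaryDigit t i : ℝ) * (1 / 2) ^ pos i

theorem half_pow_pos_add_le {pos : ℕ → ℕ} (hpos : StrictMono pos)
    (m i : ℕ) :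
    ((1 : ℝ) / 2) ^ pos (m + i) ≤ (1 / 2) ^ pos m * (1 / 2) ^ i := by
  rw [← pow_add]
  refine pow_le_pow_of_le_one (by norm_num) (by norm_num) ?_
  induction i with
  | zero => simp
  | succ i ih => have : pos (m + i) < pos (m + (i + 1)) := hpos (by omega); omega

theorem binaryDigit_mul_le {pos : ℕ → ℕ} (hpos : StrictMono pos)
    (t : ℝ) (m i : ℕ) :
    (binaryDigit t (m + i) : ℝ) * (1 / 2) ^ pos (m + i) ≤ (1 / 2) ^ pos m * (1 / 2) ^ i := by
  refine le_trans ?_ (half_pow_pos_add_le hpos m i)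
  have : (binaryDigit t (m + i) : ℝ) ≤ 1 := by exact_mod_cast binaryDigit_le_one t (m + i)
  exact mul_le_of_le_one_left (by positivity) this

theorem summable_spreadDigits {pos : ℕ → ℕ} (hpos : StrictMono pos)
    (t : ℝ) (m : ℕ) :
    Summable fun i => (binaryDigit t (m + i) : ℝ) * (1 / 2) ^ pos (m + i) := by
  refine Summable.of_nonneg_of_le (fun i => ?_) (fun i => binaryDigit_mul_le hpos t m i)
    (summable_geometric_two.mul_left _)
  have : (0 : ℝ) ≤ binaryDigit t (m + i) := by exact_mod_cast binaryDigit_nonneg t (m + i)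
  positivity

theorem spreadDigits_mem_Icc {pos : ℕ → ℕ} (hpos : StrictMono pos)
    (t : ℝ) (m : ℕ) :
    spreadDigits pos t ∈ Icc (∑ i ∈ Finset.range m, (binaryDigit t i : ℝ) * (1 / 2) ^ pos i)
      (∑ i ∈ Finset.range m, (binaryDigit t i : ℝ) * (1 / 2) ^ pos i + 2 * (1 / 2) ^ pos m) := by
  have hs : Summable fun i => (binaryDigit t i : ℝ) * (1 / 2) ^ pos i := by
    simpa using summable_spreadDigits hpos t 0
  have h := hs.sum_add_tsum_nat_add m
  have h0 : 0 ≤ ∑' i, (binaryDigit t (i + m) : ℝ) * (1 / 2) ^ pos (i + m) := by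
    refine tsum_nonneg fun i => ?_
    have : (0 : ℝ) ≤ binaryDigit t (i + m) := by exact_mod_cast binaryDigit_nonneg t (i + m)
    positivity
  have h1 : ∑' i, (binaryDigit t (i + m) : ℝ) * (1 / 2) ^ pos (i + m) ≤ 2 * (1 / 2) ^ pos m := by
    simp_rw [add_comm _ m]
    refine ((summable_spreadDigits hpos t m).tsum_le_tsum (binaryDigit_mul_le hpos t m)
      (summable_geometric_two.mul_left _)).trans ?_
    rw [tsum_mul_left, tsum_geometric_two, mul_comm]
  rw [spreadDigits, ← h]
  exact ⟨by linarith, by linarith⟩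

/-- Doubling the floor difference and adding the new digit difference is compensated by the weights,
which at least halve from one position to the next. -/
theorem floor_sub_floor_mul_le {pos : ℕ → ℕ} (hpos : StrictMono pos)
    {t u : ℝ} (ht : t ∈ Ico (0 : ℝ) 1) (hu : u ∈ Ico (0 : ℝ) 1)
    (htu : t ≤ u) (m : ℕ) :
    2 * (⌊2 ^ m * u⌋ - ⌊2 ^ m * t⌋ : ℝ) * (1 / 2) ^ pos m ≤
      ∑ i ∈ Finset.range m, (binaryDigit u i : ℝ) * (1 / 2) ^ pos i
        - ∑ i ∈ Finset.range m, (binaryDigit t i : ℝ) * (1 / 2) ^ pos i := by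
  induction m with
  | zero =>
    have h1 : ⌊t⌋ = 0 := Int.floor_eq_zero_iff.2 ht
    have h2 : ⌊u⌋ = 0 := Int.floor_eq_zero_iff.2 hu
    simp [h1, h2]
  | succ m ih =>
    rw [Finset.sum_range_succ, Finset.sum_range_succ]
    have hD : (0 : ℝ) ≤ ⌊2 ^ (m + 1) * u⌋ - ⌊2 ^ (m + 1) * t⌋ := by
      rw [sub_nonneg]; exact_mod_cast Int.floor_mono (by gcongr)
    have hw : 2 * ((1 : ℝ) / 2) ^ pos (m + 1) ≤ (1 / 2) ^ pos m := by
      have := half_pow_pos_add_le hpos m 1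
      linarith
    have hb : ∀ t : ℝ, (binaryDigit t m : ℝ) = ⌊2 ^ (m + 1) * t⌋ - 2 * ⌊2 ^ m * t⌋ := by
      intro t; simp [binaryDigit]
    rw [hb, hb]
    have := mul_le_mul_of_nonneg_left hw hD
    nlinarith

theorem half_pow_pos_le_spreadDigits_sub {pos : ℕ → ℕ} (hpos : StrictMono pos)
    {t u : ℝ} (ht : t ∈ Ico (0 : ℝ) 1)
    (hu : u ∈ Ico (0 : ℝ) 1) {m : ℕ} (h : 2 * (1 / 2) ^ m ≤ u - t) :
    (1 / 2) ^ pos m ≤ spreadDigits pos u - spreadDigits pos t := by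
  have htu : t ≤ u := by linarith [pow_pos (one_half_pos (α := ℝ)) m]
  have h1 := floor_sub_floor_mul_le hpos ht hu htu m
  have h2 := (spreadDigits_mem_Icc hpos u m).1
  have h3 := (spreadDigits_mem_Icc hpos t m).2
  -- A difference of 1 would not do: the tail of `t` could then absorb the whole gap.
  have h4 : ⌊2 ^ m * t⌋ + 2 ≤ ⌊2 ^ m * u⌋ := by
    rw [Int.le_floor]
    push_cast
    have h5 : (2 : ℝ) ^ m * (1 / 2) ^ m = 1 := by rw [← mul_pow]; norm_num
    have h6 := mul_le_mul_of_nonneg_left h (by positivity : (0 : ℝ) ≤ 2 ^ m)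
    linarith [Int.floor_le (2 ^ m * t)]
  have h7 : (2 : ℝ) ≤ ⌊2 ^ m * u⌋ - ⌊2 ^ m * t⌋ := by
    rw [le_sub_iff_add_le']; exact_mod_cast h4
  have h8 : (0 : ℝ) < (1 / 2) ^ pos m := by positivity
  nlinarith

/-- Points about `2^(-m)` apart have images at least `2^(-pos m)` apart, so the inverse of the
spreading map is `s`-Hölder. -/
theorem sub_le_mul_spreadDigits_sub_rpow {pos : ℕ → ℕ} (hpos : StrictMono pos)
    {s C : ℝ} (hs : 0 ≤ s) (hC : ∀ m, s * pos m ≤ m + C)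
    {t u : ℝ} (ht : t ∈ Ico (0 : ℝ) 1) (hu : u ∈ Ico (0 : ℝ) 1) (htu : t < u) :
    u - t ≤ 4 * 2 ^ C * |spreadDigits pos u - spreadDigits pos t| ^ s := by
  obtain ⟨n, hn1, hn2⟩ := exists_nat_pow_near_of_lt_one (x := (u - t) / 2) (y := (1 / 2 : ℝ))
    (by linarith) (by linarith [ht.1, hu.2]) (by norm_num) (by norm_num)
  have h1 := half_pow_pos_le_spreadDigits_sub hpos ht hu (m := n + 1) (by linarith)
  have h2 : ((1 / 2 : ℝ) ^ pos (n + 1)) ^ s ≤ |spreadDigits pos u - spreadDigits pos t| ^ s :=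
    Real.rpow_le_rpow (by positivity) (h1.trans (le_abs_self _)) hs
  have h3 : (1 / 2 : ℝ) ^ (n + 1) ≤ 2 ^ C * ((1 / 2 : ℝ) ^ pos (n + 1)) ^ s := by
    have h5 := hC (n + 1)
    rw [one_div, inv_pow, inv_pow, ← Real.rpow_natCast, ← Real.rpow_natCast,
      ← Real.rpow_neg (by norm_num), ← Real.rpow_neg (by norm_num), ← Real.rpow_mul (by norm_num),
      ← Real.rpow_add (by norm_num)]
    refine Real.rpow_le_rpow_of_exponent_le (by norm_num) ?_
    linarith
  have h4 := mul_le_mul_of_nonneg_left h2 (by positivity : (0 : ℝ) ≤ 2 ^ C)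
  rw [pow_succ] at h3
  linarith

theorem abs_sub_le_mul_dist_rpow {pos : ℕ → ℕ} (hpos : StrictMono pos)
    (h0 : 2 ≤ pos 0) {s C : ℝ} (hs : 0 ≤ s)
    (hC : ∀ m, s * pos m ≤ m + C) {t u : ℝ} (ht : t ∈ Ico (0 : ℝ) 1) (hu : u ∈ Ico (0 : ℝ) 1) :
    |u - t| ≤ 4 * 2 ^ C *
      dist (spreadDigits pos u : UnitAddCircle) (spreadDigits pos t : UnitAddCircle) ^ s := by
  -- On a half circle the distance is that of the real line.
  have hb : ∀ t, spreadDigits pos t ∈ Icc (0 : ℝ) (1 / 2) := by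
    intro t
    have h := spreadDigits_mem_Icc hpos t 0
    have h2 : ((1 : ℝ) / 2) ^ pos 0 ≤ (1 / 2) ^ 2 :=
      pow_le_pow_of_le_one (by norm_num) (by norm_num) h0
    simp only [Finset.range_zero, Finset.sum_empty, zero_add] at h
    exact ⟨h.1, h.2.trans (by linarith)⟩
  have hd : dist (spreadDigits pos u : UnitAddCircle) (spreadDigits pos t : UnitAddCircle)
      = |spreadDigits pos u - spreadDigits pos t| := by
    rw [dist_eq_norm, ← AddCircle.coe_sub, AddCircle.norm_coe_eq_abs_iff _ one_ne_zero, abs_one]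
    exact abs_le.2 ⟨by linarith [(hb u).1, (hb t).2], by linarith [(hb t).1, (hb u).2]⟩
  rw [hd]
  rcases lt_trichotomy t u with h | rfl | h
  · rw [abs_of_pos (sub_pos.2 h)]
    exact sub_le_mul_spreadDigits_sub_rpow hpos hs hC ht hu h
  · rw [sub_self, abs_zero]; positivity
  · rw [abs_sub_comm, abs_of_pos (sub_pos.2 h), abs_sub_comm (spreadDigits pos u)]
    exact sub_le_mul_spreadDigits_sub_rpow hpos hs hC hu ht h

/-- If `pos m ≤ (1 + o(1)) m`, the set of the points of the circle whose binary digits vanish off the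
range of `pos` has Hausdorff dimension one. -/
theorem one_le_dimH_image_spreadDigits {pos : ℕ → ℕ} (hpos : StrictMono pos)
    (h0 : 2 ≤ pos 0)
    (hC : ∀ s : ℝ, 0 < s → s < 1 → ∃ C : ℝ, ∀ m, s * pos m ≤ m + C) :
    1 ≤ dimH ((fun t => (spreadDigits pos t : UnitAddCircle)) '' Ico (0 : ℝ) 1) := by
  refine ENNReal.le_of_forall_nnreal_lt fun s hs => ?_
  have hs1 : s < 1 := by exact_mod_cast hs
  rcases eq_zero_or_pos s with rfl | hs0
  · simp
  obtain ⟨C, hC⟩ := hC s (by exact_mod_cast hs0) (by exact_mod_cast hs1)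
  set g : ℝ → UnitAddCircle := fun t => (spreadDigits pos t : UnitAddCircle) with hg
  have key : ∀ t ∈ Ico (0 : ℝ) 1, ∀ u ∈ Ico (0 : ℝ) 1,
      |u - t| ≤ 4 * 2 ^ C * dist (g u) (g t) ^ (s : ℝ) :=
    fun t ht u hu => abs_sub_le_mul_dist_rpow hpos h0 s.2 hC ht hu
  have hinj : InjOn g (Ico 0 1) := by
    intro u hu t ht h
    have := key t ht u hu
    rw [h, dist_self, Real.zero_rpow (by exact_mod_cast hs0.ne'), mul_zero] at this
    exact sub_eq_zero.1 (abs_nonpos_iff.1 this)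
  have hleft := hinj.leftInvOn_invFunOn
  -- The inverse maps the image onto `[0, 1)` and multiplies dimension by at most `1 / s`, so the
  -- image has dimension at least `s`.
  have hhold : HolderOnWith (Real.toNNReal (4 * 2 ^ C)) s (Function.invFunOn g (Ico 0 1))
      (g '' Ico 0 1) := by
    rintro _ ⟨u, hu, rfl⟩ _ ⟨t, ht, rfl⟩
    rw [hleft hu, hleft ht, edist_dist, edist_dist, ENNReal.ofReal_rpow_of_nonneg dist_nonneg s.coe_nonneg]
    change _ ≤ ENNReal.ofReal _ * _
    rw [← ENNReal.ofReal_mul (by positivity)]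
    exact ENNReal.ofReal_le_ofReal (key t ht u hu)
  have h := hhold.dimH_image_le hs0
  rw [hleft.image_image, Real.dimH_of_nonempty_interior (by simp)] at h
  simp only [Module.finrank_self, Nat.cast_one] at h
  rwa [ENNReal.le_div_iff_mul_le (Or.inl (by exact_mod_cast hs0.ne')) (Or.inl (by simp)),
    one_mul] at h

/-- Multiplication by `2^k` makes the digits before the block integral. The spare 4 zeros bring the
scaled tail down to `2 / 16`. -/
theorem exists_int_abs_sub_le {pos : ℕ → ℕ} (hpos : StrictMono pos)
    {k l m : ℕ} (hk : ∀ i < m, pos i ≤ k) (hl : k + l + 4 ≤ pos m) (t : ℝ) :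
    ∃ z : ℤ, 2 ^ l * |2 ^ k * spreadDigits pos t - z| ≤ 1 / 8 := by
  refine ⟨∑ i ∈ Finset.range m, binaryDigit t i * 2 ^ (k - pos i), ?_⟩
  have h1 : ((∑ i ∈ Finset.range m, binaryDigit t i * 2 ^ (k - pos i) : ℤ) : ℝ)
      = 2 ^ k * ∑ i ∈ Finset.range m, (binaryDigit t i : ℝ) * (1 / 2) ^ pos i := by
    push_cast
    rw [Finset.mul_sum]
    refine Finset.sum_congr rfl fun i hi => ?_
    rw [pow_sub₀ _ two_ne_zero (hk i (Finset.mem_range.1 hi)), one_div, inv_pow]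
    ring
  obtain ⟨h2, h3⟩ := spreadDigits_mem_Icc hpos t m
  rw [h1, ← mul_sub, abs_mul, abs_of_nonneg (sub_nonneg.2 h2),
    abs_of_pos (by positivity : (0 : ℝ) < 2 ^ k), ← mul_assoc, ← pow_add]
  have h4 : ((1 : ℝ) / 2) ^ pos m ≤ (1 / 2) ^ (l + k + 4) :=
    pow_le_pow_of_le_one (by norm_num) (by norm_num) (by omega)
  have h5 : (2 : ℝ) ^ (l + k) * (1 / 2) ^ (l + k + 4) = 1 / 16 := by
    rw [pow_add _ (l + k) 4, ← mul_assoc, ← mul_pow]; norm_num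
  calc _ ≤ (2 : ℝ) ^ (l + k) * (2 * (1 / 2) ^ (l + k + 4)) := by
        gcongr; linarith
    _ = 1 / 8 := by rw [mul_left_comm, h5]; norm_num
-- The set with sparse blocks of zeros, and the orders of divergence.
/-- The length `2 ^ (j ^ 2)` of the `j`-th block of vanishing digits. -/
def gapLength (j : ℕ) : ℕ := 2 ^ (j ^ 2)

/-- The number of free digits before the `j`-th block of vanishing digits. -/
def gapStart (j : ℕ) : ℕ := 2 ^ j * gapLength j

/-- The indices of the blocks which precede the `i`-th free digit. -/
def gapsBefore (i : ℕ) : Finset ℕ := (Finset.range (i + 1)).filter fun j => gapStart j ≤ i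

/-- The position of the `i`-th free digit. -/
def freePosition (i : ℕ) : ℕ := i + 2 + ∑ j ∈ gapsBefore i, (gapLength j + 4)

theorem lt_gapStart (j : ℕ) : j < gapStart j := by
  have h1 : 1 ≤ gapLength j := Nat.one_le_two_pow
  have h2 : j < 2 ^ j := Nat.lt_two_pow_self
  unfold gapStart
  nlinarith

theorem mem_gapsBefore {i j : ℕ} : j ∈ gapsBefore i ↔ gapStart j ≤ i := by
  have := lt_gapStart j
  simp only [gapsBefore, Finset.mem_filter, Finset.mem_range]
  omega

theorem freePosition_strictMono : StrictMono freePosition := by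
  refine strictMono_nat_of_lt_succ fun i => ?_
  have : gapsBefore i ⊆ gapsBefore (i + 1) := fun j hj =>
    mem_gapsBefore.2 ((mem_gapsBefore.1 hj).trans (Nat.le_succ i))
  have := Finset.sum_le_sum_of_subset (f := fun j => gapLength j + 4) this
  unfold freePosition
  omega

theorem two_le_freePosition_zero : 2 ≤ freePosition 0 := by
  unfold freePosition; omega

theorem freePosition_add_le {i j : ℕ} (hi : i < gapStart j) :
    freePosition i + (gapLength j + 4) ≤ freePosition (gapStart j) := by
  have hj : j ∉ gapsBefore i := fun h => by have := mem_gapsBefore.1 h; omega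
  have : insert j (gapsBefore i) ⊆ gapsBefore (gapStart j) := by
    intro k hk
    rcases Finset.mem_insert.1 hk with rfl | hk
    · exact mem_gapsBefore.2 le_rfl
    · exact mem_gapsBefore.2 ((mem_gapsBefore.1 hk).trans hi.le)
  have := Finset.sum_le_sum_of_subset (f := fun j => gapLength j + 4) this
  rw [Finset.sum_insert hj] at this
  unfold freePosition
  omega

theorem sum_half_pow_Ico_le (a b : ℕ) :
    ∑ j ∈ Finset.Ico a (a + b), ((1 : ℝ) / 2) ^ j ≤ 2 * (1 / 2) ^ a := by
  rw [Finset.sum_Ico_eq_sum_range, Nat.add_sub_cancel_left]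
  simp_rw [pow_add]
  rw [← Finset.mul_sum, mul_comm]
  gcongr
  exact (summable_geometric_two.sum_le_tsum _ fun i _ => by positivity).trans_eq tsum_geometric_two

/-- A block preceding the `m`-th free digit has length at most `2^(-j) m`. The blocks from `a` on
therefore total at most `10 · 2^(-a) m ≤ (1 - s) m`, and the finitely many others go into `C`. The
conclusion uses `s (2 - s) ≤ 1`. -/
theorem exists_mul_freePosition_le {s : ℝ} (hs : 0 < s) (hs1 : s < 1) :
    ∃ C : ℝ, ∀ m, s * freePosition m ≤ m + C := by
  obtain ⟨a, ha⟩ := exists_pow_lt_of_lt_one (by linarith : 0 < (1 - s) / 10)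
    (by norm_num : (1 / 2 : ℝ) < 1)
  set A : ℝ := ∑ j ∈ Finset.range a, ((gapLength j : ℝ) + 4) with hA
  have hA0 : 0 ≤ A := Finset.sum_nonneg fun j _ => by positivity
  refine ⟨2 + A, fun m => ?_⟩
  have h1 : ∑ j ∈ (gapsBefore m).filter (· < a), ((gapLength j : ℝ) + 4) ≤ A := by
    refine Finset.sum_le_sum_of_subset_of_nonneg (fun j hj => ?_) fun j _ _ => by positivity
    exact Finset.mem_range.2 (Finset.mem_filter.1 hj).2
  have h2 : ∑ j ∈ (gapsBefore m).filter (¬ · < a), ((gapLength j : ℝ) + 4) ≤ m * (1 - s) := by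
    calc _ ≤ ∑ j ∈ (gapsBefore m).filter (¬ · < a), 5 * m * ((1 : ℝ) / 2) ^ j := by
          refine Finset.sum_le_sum fun j hj => ?_
          have h3 : ((2 ^ j * gapLength j : ℕ) : ℝ) ≤ m := by
            exact_mod_cast mem_gapsBefore.1 (Finset.mem_filter.1 hj).1
          have h4 : (1 : ℝ) ≤ gapLength j := by exact_mod_cast (Nat.one_le_two_pow : 1 ≤ 2 ^ (j ^ 2))
          have h5 : (2 : ℝ) ^ j * (1 / 2) ^ j = 1 := by rw [← mul_pow]; norm_num
          have h6 : (0 : ℝ) < (1 / 2) ^ j := by positivity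
          push_cast at h3
          have h7 := mul_le_mul_of_nonneg_right h3 h6.le
          have h8 : (2 : ℝ) ^ j * gapLength j * (1 / 2) ^ j = gapLength j := by
            rw [mul_right_comm, h5, one_mul]
          linarith
      _ ≤ ∑ j ∈ Finset.Ico a (a + (m + 1)), 5 * m * ((1 : ℝ) / 2) ^ j := by
          refine Finset.sum_le_sum_of_subset_of_nonneg (fun j hj => ?_) fun j _ _ => by positivity
          have := mem_gapsBefore.1 (Finset.mem_filter.1 hj).1
          have := lt_gapStart j
          have := (Finset.mem_filter.1 hj).2
          rw [Finset.mem_Ico]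
          omega
      _ ≤ 5 * m * (2 * (1 / 2) ^ a) := by
          rw [← Finset.mul_sum]
          gcongr
          exact sum_half_pow_Ico_le a (m + 1)
      _ ≤ m * (1 - s) := by
          have : (0 : ℝ) ≤ m := by positivity
          nlinarith
  have h3 := Finset.sum_filter_add_sum_filter_not (gapsBefore m) (· < a)
    (fun j => (gapLength j : ℝ) + 4)
  have h4 : (freePosition m : ℝ) ≤ m + 2 + (A + m * (1 - s)) := by
    unfold freePosition
    push_cast
    linarith
  have hm : (0 : ℝ) ≤ m := by positivity
  calc s * freePosition m ≤ s * (m + 2 + (A + m * (1 - s))) := by gcongr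
    _ ≤ m + (2 + A) := by nlinarith [mul_nonneg hm (sq_nonneg (1 - s))]

/-- The set of points of the circle all of whose blocks of digits given by `gapLength`,
`gapStart` vanish. -/
noncomputable def gapSet : Set UnitAddCircle :=
  (fun t => (spreadDigits freePosition t : UnitAddCircle)) '' Ico (0 : ℝ) 1

theorem one_le_dimH_gapSet : 1 ≤ dimH gapSet :=
  one_le_dimH_image_spreadDigits freePosition_strictMono two_le_freePosition_zero
    fun _ hs hs1 => exists_mul_freePosition_le hs hs1

/-- The position of the beginning of the `j`-th block of vanishing digits. -/
def gapPosition (j : ℕ) : ℕ := freePosition (gapStart j) - (gapLength j + 4)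

theorem gapPosition_add (j : ℕ) :
    gapPosition j + gapLength j + 4 = freePosition (gapStart j) := by
  have h := freePosition_add_le (i := 0) ((Nat.zero_le j).trans_lt (lt_gapStart j))
  unfold gapPosition
  omega

/-- The order of the partial sums which are large on the whole of `gapSet`. -/
def divergenceOrder (j : ℕ) : ℕ := 2 ^ gapPosition j * 2 ^ gapLength j

theorem log_divergenceOrder (j : ℕ) :
    Real.log (divergenceOrder j) = (gapPosition j + gapLength j) * Real.log 2 := by
  unfold divergenceOrder
  push_cast
  rw [← pow_add, Real.log_pow]
  push_cast
  ring

theorem half_le_log_two : (1 : ℝ) / 2 ≤ Real.log 2 := by linarith [Real.log_two_gt_d9]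

theorem le_divergenceOrder (j : ℕ) : j ≤ divergenceOrder j := by
  have h1 : j < 2 ^ (j ^ 2) :=
    Nat.lt_two_pow_self.trans_le (Nat.pow_le_pow_right two_pos (Nat.le_self_pow two_ne_zero j))
  have h2 : gapLength j < 2 ^ gapLength j := Nat.lt_two_pow_self
  have h3 : 1 ≤ 2 ^ gapPosition j := Nat.one_le_two_pow
  unfold divergenceOrder
  have h4 : gapLength j = 2 ^ (j ^ 2) := rfl
  nlinarith

theorem gapLength_div_two_le_log_divergenceOrder (j : ℕ) :
    (gapLength j : ℝ) / 2 ≤ Real.log (divergenceOrder j) := by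
  rw [log_divergenceOrder]
  have := half_le_log_two
  have h1 : (0 : ℝ) ≤ gapPosition j := by positivity
  have h2 : (0 : ℝ) ≤ gapLength j := by positivity
  nlinarith

/-- Compared with the size of the large partial sums, of order `gapLength j`, only the factor `2 ^
j` is lost. -/
theorem exists_log_divergenceOrder_le :
    ∃ C : ℝ, 0 ≤ C ∧ ∀ j, Real.log (divergenceOrder j) ≤ 2 * (2 ^ j * gapLength j) + C := by
  obtain ⟨C, hC⟩ := exists_mul_freePosition_le (s := 1 / 2) (by norm_num) (by norm_num)
  refine ⟨2 * |C|, by positivity, fun j => ?_⟩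
  have h1 := hC (gapStart j)
  have h2 : (gapPosition j : ℝ) + gapLength j + 4 = freePosition (gapStart j) := by
    exact_mod_cast gapPosition_add j
  have h3 : (gapStart j : ℝ) = 2 ^ j * gapLength j := by simp [gapStart]
  have h4 : Real.log 2 ≤ 1 := by linarith [Real.log_two_lt_d9]
  have h5 : (0 : ℝ) ≤ gapPosition j + gapLength j := by positivity
  rw [log_divergenceOrder, ← h3]
  have := le_abs_self C
  nlinarith

theorem gapLength_div_four_le_norm_fourierPartialSum (j : ℕ) {x : UnitAddCircle} (hx : x ∈ gapSet) :
    (gapLength j : ℝ) / 4 ≤ ‖fourierPartialSum (divergenceOrder j)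
      (fejerPolynomial (2 ^ gapPosition j) (2 ^ gapLength j)) x‖ := by
  obtain ⟨t, _, rfl⟩ := hx
  have hle : ∀ i < gapStart j, freePosition i ≤ gapPosition j := by
    intro i hi
    have := freePosition_add_le hi
    unfold gapPosition
    omega
  obtain ⟨z, hz⟩ := exists_int_abs_sub_le freePosition_strictMono hle (gapPosition_add j).le t
  have h := half_log_le_norm_fourierPartialSum_fejerPolynomial (K := 2 ^ gapPosition j)
    (n := 2 ^ gapLength j) (by positivity) (y := spreadDigits freePosition t) (z := z)
    (by push_cast; exact hz)
  refine le_trans ?_ h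
  have h1 : Real.log (2 ^ gapLength j) ≤ Real.log ((2 ^ gapLength j : ℕ) + 1) :=
    Real.log_le_log (by positivity) (by push_cast; linarith)
  rw [Real.log_pow] at h1
  have := half_le_log_two
  have h2 : (0 : ℝ) ≤ gapLength j := by positivity
  nlinarith

theorem tendsto_gapLength_atTop : Tendsto (fun j => (gapLength j : ℝ)) atTop atTop := by
  refine tendsto_atTop_mono (fun j => ?_) tendsto_natCast_atTop_atTop
  have : j < 2 ^ (j ^ 2) :=
    Nat.lt_two_pow_self.trans_le (Nat.pow_le_pow_right two_pos (Nat.le_self_pow two_ne_zero j))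
  exact_mod_cast this.le

/-! ### The Baire category argument. -/

/-- The functions whose partial sum of some order `divergenceOrder j`, with `j ≥ M`, is
large on the whole of `gapSet`. -/
def largePartialSums (M : ℕ) : Set C(UnitAddCircle, ℂ) :=
  {f | ∃ j ≥ M, ∀ x ∈ gapSet,
    Real.log (divergenceOrder j) ≤ 4 ^ j * ‖fourierPartialSum (divergenceOrder j) f x‖}

theorem dense_interior_largePartialSums (M : ℕ) : Dense (interior (largePartialSums M)) := by
  rw [Metric.dense_iff]
  intro f ε hε
  have hf : f ∈ closure (Submodule.span ℂ (Set.range (@fourier 1)) : Set C(UnitAddCircle, ℂ)) := by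
    rw [← Submodule.topologicalClosure_coe, span_fourier_closure_eq_top]
    trivial
  obtain ⟨g, hg, hfg⟩ := Metric.mem_closure_iff.1 hf (ε / 2) (by positivity)
  obtain ⟨N, hN⟩ := exists_forall_fourierPartialSum_eq hg
  obtain ⟨C, hC0, hC⟩ := exists_log_divergenceOrder_le
  have hhalf : Tendsto (fun j : ℕ => ((1 : ℝ) / 2) ^ j) atTop (𝓝 0) :=
    tendsto_pow_atTop_nhds_zero_of_lt_one (by norm_num) (by norm_num)
  -- The perturbation `ε / 14 • P` has norm below `ε / 2` and a partial sum at least `ε / 56 *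
  -- gapLength j` on `gapSet`. Half of this pays for `C + ‖g‖ + 1`, the other half exceeds `2 * (1 /
  -- 2) ^ j * gapLength j`.
  obtain ⟨j, hjM, hjN, hj1, hj2⟩ := ((eventually_ge_atTop M).and ((eventually_ge_atTop N).and
    ((hhalf.eventually_lt_const (by positivity : 0 < ε / 224)).and
    (tendsto_gapLength_atTop.eventually_ge_atTop ((C + ‖g‖ + 1) * (112 / ε)))))).exists
  set P := fejerPolynomial (2 ^ gapPosition j) (2 ^ gapLength j) with hP
  set n := divergenceOrder j with hn
  set h : C(UnitAddCircle, ℂ) := g + ((ε / 14 : ℝ) : ℂ) • P with hh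
  have hbig : ∀ x ∈ gapSet, ε / 14 * (gapLength j / 4) - ‖g‖ ≤ ‖fourierPartialSum n h x‖ := by
    intro x hx
    rw [hh, fourierPartialSum_add, fourierPartialSum_smul, hN n (hjN.trans (le_divergenceOrder j))]
    have h1 := norm_sub_norm_le (((ε / 14 : ℝ) : ℂ) * fourierPartialSum n P x) (-g x)
    rw [norm_neg, norm_mul, Complex.norm_real, Real.norm_of_nonneg (by positivity), sub_neg_eq_add,
      add_comm _ (g x)] at h1
    have h2 := mul_le_mul_of_nonneg_left (gapLength_div_four_le_norm_fourierPartialSum j hx)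
      (by positivity : 0 ≤ ε / 14)
    linarith [g.norm_coe_le_norm x]
  set L := 2 * Real.log (2 * n + 2) with hL
  have hLpos : 0 < L := mul_pos two_pos (Real.log_pos (by linarith [(Nat.cast_nonneg n : (0 : ℝ) ≤ n)]))
  -- By the logarithmic bound, moving `h` by less than `1 / L` changes its partial sum of order `n`
  -- by at most 1.
  refine ⟨h, ?_, mem_interior_iff_mem_nhds.2 (Metric.mem_nhds_iff.2 ⟨1 / L, by positivity, ?_⟩)⟩
  · have h1 : dist h g ≤ ε / 14 * 6 := by
      rw [hh, dist_eq_norm, add_sub_cancel_left, norm_smul, Complex.norm_real,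
        Real.norm_of_nonneg (by positivity)]
      gcongr
      exact norm_fejerPolynomial_le _ _
    rw [Metric.mem_ball]
    have := dist_triangle h g f
    rw [dist_comm g f] at this
    linarith
  · intro f' hf'
    refine ⟨j, hjM, fun x hx => ?_⟩
    have h1 : ‖fourierPartialSum n h x‖ - 1 ≤ ‖fourierPartialSum n f' x‖ := by
      have h2 := norm_fourierPartialSum_le n (f' - h) x
      rw [Metric.mem_ball, dist_eq_norm, lt_div_iff₀ hLpos, mul_comm] at hf'
      have h3 : fourierPartialSum n h x = fourierPartialSum n f' x
          - fourierPartialSum n (f' - h : C(UnitAddCircle, ℂ)) x := by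
        rw [eq_sub_iff_add_eq, ← fourierPartialSum_add, add_sub_cancel]
      rw [h3]
      have h4 := norm_sub_le (fourierPartialSum n f' x)
        (fourierPartialSum n (f' - h : C(UnitAddCircle, ℂ)) x)
      linarith
    have h2 := hbig x hx
    have hl : (0 : ℝ) ≤ gapLength j := by positivity
    have h3 : C + ‖g‖ + 1 ≤ ε / 112 * gapLength j := by
      have := mul_le_mul_of_nonneg_left hj2 (by positivity : 0 ≤ ε / 112)
      calc C + ‖g‖ + 1 = ε / 112 * ((C + ‖g‖ + 1) * (112 / ε)) := by field_simp
        _ ≤ _ := this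
    have h4 : 2 * (1 / 2) ^ j * gapLength j + C ≤ ‖fourierPartialSum n f' x‖ := by
      have := mul_le_mul_of_nonneg_right hj1.le hl
      linarith
    have h5 : (4 : ℝ) ^ j * (1 / 2) ^ j = 2 ^ j := by rw [← mul_pow]; norm_num
    have h6 : (1 : ℝ) ≤ 4 ^ j := one_le_pow₀ (by norm_num)
    calc Real.log n ≤ 2 * (2 ^ j * gapLength j) + C := hC j
      _ ≤ 4 ^ j * (2 * (1 / 2) ^ j * gapLength j + C) := by
        rw [← h5]
        nlinarith
      _ ≤ _ := by gcongr

theorem eventually_residual_mem_largePartialSums :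
    ∀ᶠ f in residual C(UnitAddCircle, ℂ), ∀ M, f ∈ largePartialSums M :=
  eventually_countable_forall.2 fun M => mem_of_superset
    (residual_of_dense_open isOpen_interior (dense_interior_largePartialSums M)) interior_subset

/-! ### The two bounds on the limsup, and the conclusion. -/

theorem tendsto_log_log_atTop : Tendsto (fun n : ℕ => Real.log (Real.log n)) atTop atTop :=
  Real.tendsto_log_atTop.comp (Real.tendsto_log_atTop.comp tendsto_natCast_atTop_atTop)

theorem limsup_log_norm_fourierPartialSum_le_one (f : C(UnitAddCircle, ℂ)) (x : UnitAddCircle) :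
    limsup (fun n : ℕ => ENNReal.log ‖fourierPartialSum n f x‖ₑ /
      ((Real.log (Real.log n) : ℝ) : EReal)) atTop ≤ 1 := by
  refine le_of_forall_gt_imp_ge_of_dense fun c hc => ?_
  obtain ⟨b, hb1, hbc⟩ := EReal.lt_iff_exists_real_btwn.1 hc
  have hb : 1 < b := by exact_mod_cast hb1
  refine (limsup_le_of_le (by isBoundedDefault) ?_).trans hbc.le
  set A : ℝ := 4 * ‖f‖ + 1 with hA
  have hA0 : 0 < A := by positivity
  filter_upwards [eventually_ge_atTop 4, tendsto_log_log_atTop.eventually_gt_atTop 0,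
    tendsto_log_log_atTop.eventually_ge_atTop (Real.log A / (b - 1))] with n hn hpos hlarge
  have hn' : (4 : ℝ) ≤ n := by exact_mod_cast hn
  have hlog : 0 < Real.log n := Real.log_pos (by linarith)
  have h1 : ‖fourierPartialSum n f x‖ ≤ A * Real.log n := by
    have h2 : Real.log (2 * n + 2) ≤ 2 * Real.log n := by
      have := Real.log_le_log (by positivity : (0 : ℝ) < 2 * n + 2)
        (by nlinarith : 2 * (n : ℝ) + 2 ≤ (n : ℝ) ^ 2)
      rwa [Real.log_pow] at this
    have h3 := mul_le_mul_of_nonneg_right h2 (norm_nonneg f)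
    have := norm_fourierPartialSum_le n f x
    nlinarith
  have h2 : ENNReal.log ‖fourierPartialSum n f x‖ₑ ≤ (Real.log (A * Real.log n) : ℝ) := by
    rw [← ENNReal.log_ofReal_of_pos (by positivity), ← ofReal_norm]
    exact ENNReal.log_le_log (ENNReal.ofReal_le_ofReal h1)
  refine (EReal.div_le_div_right_of_nonneg (by exact_mod_cast hpos.le) h2).trans ?_
  rw [← EReal.coe_div]
  refine EReal.coe_le_coe_iff.2 ?_
  rw [div_le_iff₀ hpos, Real.log_mul hA0.ne' hlog.ne']
  rw [div_le_iff₀ (by linarith)] at hlarge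
  linarith

theorem one_le_limsup_log_norm_fourierPartialSum {f : C(UnitAddCircle, ℂ)}
    (hf : ∀ M, f ∈ largePartialSums M) {x : UnitAddCircle} (hx : x ∈ gapSet) :
    1 ≤ limsup (fun n : ℕ => ENNReal.log ‖fourierPartialSum n f x‖ₑ /
      ((Real.log (Real.log n) : ℝ) : EReal)) atTop := by
  refine le_of_forall_lt_imp_le_of_dense fun c hc => ?_
  obtain ⟨a, hca, ha1⟩ := EReal.lt_iff_exists_real_btwn.1 hc
  have ha : a < 1 := by exact_mod_cast ha1
  refine hca.le.trans (le_limsup_of_frequently_le' (frequently_atTop.2 fun m => ?_))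
  obtain ⟨j, hj, hlarge⟩ := hf (max m (max 2 ⌈4 / (1 - a)⌉₊))
  have hjm : m ≤ j := (le_max_left _ _).trans hj
  have hj2 : 2 ≤ j := (le_max_left _ _).trans ((le_max_right _ _).trans hj)
  have hja : 4 / (1 - a) ≤ j :=
    (Nat.le_ceil _).trans (by exact_mod_cast (le_max_right _ _).trans ((le_max_right _ _).trans hj))
  refine ⟨divergenceOrder j, hjm.trans (le_divergenceOrder j), ?_⟩
  have hS := hlarge x hx
  set S := ‖fourierPartialSum (divergenceOrder j) f x‖ with hSdef
  have hlog := gapLength_div_two_le_log_divergenceOrder j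
  have hl : (0 : ℝ) < gapLength j := by exact_mod_cast (Nat.two_pow_pos (j ^ 2) : 0 < 2 ^ (j ^ 2))
  have hlog0 : 0 < Real.log (divergenceOrder j) := by linarith
  have hS0 : 0 < S := pos_of_mul_pos_right (hlog0.trans_le hS) (by positivity)
  have h2 : ((j : ℝ) ^ 2 - 1) * Real.log 2 ≤ Real.log (Real.log (divergenceOrder j)) := by
    have := Real.log_le_log (by positivity) hlog
    rw [Real.log_div hl.ne' two_ne_zero, gapLength, Nat.cast_pow, Real.log_pow] at this
    push_cast at this
    linarith
  have h3 : Real.log (Real.log (divergenceOrder j)) ≤ 2 * j * Real.log 2 + Real.log S := by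
    have := Real.log_le_log hlog0 hS
    rw [Real.log_mul (by positivity) hS0.ne', Real.log_pow, show (4 : ℝ) = 2 ^ 2 by norm_num,
      Real.log_pow] at this
    push_cast at this
    linarith
  have hlog2 : 0 < Real.log 2 := Real.log_pos one_lt_two
  have hj2' : (2 : ℝ) ≤ j := by exact_mod_cast hj2
  -- The loss `log (4 ^ j)` is linear in `j` and `log log` of the order at least quadratic: this is
  -- why the block lengths are `2 ^ (j ^ 2)`.
  have h4 : 2 * (j : ℝ) ≤ (1 - a) * ((j : ℝ) ^ 2 - 1) := by
    rw [div_le_iff₀ (by linarith)] at hja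
    nlinarith
  have hpos : 0 < Real.log (Real.log (divergenceOrder j)) :=
    lt_of_lt_of_le (mul_pos (by nlinarith) hlog2) h2
  have h5 : a * Real.log (Real.log (divergenceOrder j)) ≤ Real.log S := by
    have h6 := mul_le_mul_of_nonneg_left h2 (by linarith : 0 ≤ 1 - a)
    have h7 := mul_le_mul_of_nonneg_right h4 hlog2.le
    linarith
  rw [← ofReal_norm, ENNReal.log_ofReal_of_pos hS0, ← EReal.coe_div]
  exact EReal.coe_le_coe_iff.2 ((le_div_iff₀ hpos).2 h5)

theorem dimH_unitAddCircle_le_one (s : Set UnitAddCircle) : dimH s ≤ 1 := by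
  have hlip : LipschitzWith 1 (fun t : ℝ => (t : UnitAddCircle)) := by
    refine LipschitzWith.of_dist_le_mul fun t u => ?_
    rw [NNReal.coe_one, one_mul, dist_eq_norm, dist_eq_norm, ← AddCircle.coe_sub]
    exact QuotientAddGroup.norm_mk_le_norm
  calc dimH s ≤ dimH (Set.range fun t : ℝ => (t : UnitAddCircle)) :=
        dimH_mono fun x _ => QuotientAddGroup.mk_surjective x
    _ ≤ dimH (univ : Set ℝ) := hlip.dimH_range_le
    _ = 1 := Real.dimH_univ

theorem theorem3 :
    ∀ᶠ f : C(UnitAddCircle, ℂ) in residual C(UnitAddCircle, ℂ), dimH (logDivergenceLevelSet 1 f) = 1 := by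
  filter_upwards [eventually_residual_mem_largePartialSums] with f hf
  refine le_antisymm (dimH_unitAddCircle_le_one _) (one_le_dimH_gapSet.trans (dimH_mono ?_))
  intro x hx
  exact le_antisymm (limsup_log_norm_fourierPartialSum_le_one f x)
    (one_le_limsup_log_norm_fourierPartialSum hf hx)
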